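/- For a positive integer $n$, let $K_{n,n}$ denote the complete bipartite graph with two sides of size $n$. Let $b(2,2,3)$ be the least positive integer $n$ such that every colouring of the edges of $K_{n,n}$ with the three colours $1,2,3$ contains a copy of $K_{2,2}$ all of whose edges have colour $1$, or a copy of $K_{2,2}$ all of whose edges have colour $2$, or a copy of $K_{3,3}$ all of whose edges have colour $3$. Then $$17\le b(2,2,3)\le 18.$$ -/

import Mathlib

open scoped SimpleGraph

/-- `BipartiteArrows t n`: in every colouring of the edges of `K_{n,n}` with `k` colours there is a
colour `i` such that the graph formed by the edges of colour `i` contains a copy of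
`K_{t i, t i}`. -/
def BipartiteArrows {k : ℕ} (t : Fin k → ℕ) (n : ℕ) : Prop :=
  ∀ C : (completeBipartiteGraph (Fin n) (Fin n)).EdgeLabeling (Fin k),
    ∃ i : Fin k, completeBipartiteGraph (Fin (t i)) (Fin (t i)) ⊑ C.labelGraph i

/-- The multicolour bipartite Ramsey number `b(t 0, …, t (k - 1))`: the least `n` such that
every colouring of the edges of `K_{n,n}` with `k` colours contains, for some `i`, a copy of
`K_{t i, t i}` all of whose edges have colour `i`. -/
noncomputable def bipartiteRamsey {k : ℕ} (t : Fin k → ℕ) : ℕ :=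
  sInf {n : ℕ | BipartiteArrows t n}

/-! Upper bound: in an 18 × 18 grid a `K_{2,2}`-free class has at most 82 edges and a `K_{3,3}`-free
class at most 158, and 82 + 82 + 158 = 322 < 324. Both bounds (`sum_dg_le_of_not_hasBiclique_two`,
`sum_dg_le_of_not_hasBiclique_three`) count the common neighbours of pairs and exploit integrality
of the degrees. Lower bound: `differenceColour` gives a translation-invariant colouring of the 16 ×
16 grid, so a biclique can be moved to have a left vertex at 0, which leaves a finite check. -/

open Finset

section Counting

variable {α β : Type*} [Fintype α] [Fintype β]

/-- The relation `r` contains a complete `t × t` bipartite subrelation. -/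
def HasBiclique {α β : Type*} (r : α → β → Prop) (t : ℕ) : Prop :=
  ∃ (S : Finset α) (T : Finset β), #S = t ∧ #T = t ∧ ∀ a ∈ S, ∀ b ∈ T, r a b

theorem HasBiclique.swap {α β : Type*} {r : α → β → Prop} {t : ℕ}
    (h : HasBiclique (Function.swap r) t) : HasBiclique r t := by
  obtain ⟨S, T, hS, hT, h⟩ := h
  exact ⟨T, S, hT, hS, fun a ha b hb => h b hb a ha⟩

open Classical in
/-- The neighbours of `a` under `r`. -/
noncomputable def nbrs {α β : Type*} [Fintype β] (r : α → β → Prop) (a : α) : Finset β :=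
  univ.filter (r a)

/-- The number of neighbours of `a` under `r`, as an integer. -/
noncomputable def dg {α β : Type*} [Fintype β] (r : α → β → Prop) (a : α) : ℤ := #(nbrs r a)

theorem mem_nbrs {α β : Type*} [Fintype β] {r : α → β → Prop} {a : α} {b : β} :
    b ∈ nbrs r a ↔ r a b := by
  simp [nbrs]

theorem sum_sum_nbrs (r : α → β → Prop) (f : β → ℤ) :
    ∑ a, ∑ b ∈ nbrs r a, f b = ∑ b, dg (Function.swap r) b * f b := by
  classical
  have h : ∀ b, dg (Function.swap r) b * f b = ∑ a ∈ nbrs (Function.swap r) b, f b := by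
    intro b; simp [dg]
  simp_rw [h]
  exact sum_comm' (by simp [mem_nbrs, Function.swap])

theorem sum_dg_swap (r : α → β → Prop) : ∑ b, dg (Function.swap r) b = ∑ a, dg r a := by
  have := sum_sum_nbrs r (fun _ => 1)
  simpa [dg] using this.symm

/-- Double counting of the common neighbours of `u` with the other vertices of its side. -/
theorem sum_card_nbrs_inter [DecidableEq α] [DecidableEq β] (r : α → β → Prop) (u : α) :
    ∑ v ∈ univ.erase u, (#(nbrs r u ∩ nbrs r v) : ℤ)
      = ∑ b ∈ nbrs r u, (dg (Function.swap r) b - 1) := by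
  have h1 : ∀ v, (#(nbrs r u ∩ nbrs r v) : ℤ) = ∑ b ∈ nbrs r u ∩ nbrs r v, (1 : ℤ) := by
    intro v; simp
  have h2 : ∀ b ∈ nbrs r u, dg (Function.swap r) b - 1
      = ∑ v ∈ (nbrs (Function.swap r) b).erase u, (1 : ℤ) := by
    intro b hb
    have hu : u ∈ nbrs (Function.swap r) b := by simpa [mem_nbrs, Function.swap] using hb
    have := card_erase_add_one hu
    simp only [dg, sum_const, nsmul_eq_mul, mul_one]
    omega
  simp_rw [h1]
  rw [sum_congr rfl h2]
  refine sum_comm' ?_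
  simp only [mem_erase, mem_univ, mem_inter, mem_nbrs, Function.swap]
  tauto

theorem sum_codegree (r : α → β → Prop) :
    ∑ a, ∑ b ∈ nbrs r a, (dg (Function.swap r) b - 1)
      = ∑ b, dg (Function.swap r) b * (dg (Function.swap r) b - 1) :=
  sum_sum_nbrs r _

theorem card_nbrs_inter_le_one {α β : Type*} [Fintype β] [DecidableEq β] {r : α → β → Prop} (h : ¬ HasBiclique r 2)
    {u v : α} (huv : u ≠ v) : #(nbrs r u ∩ nbrs r v) ≤ 1 := by
  classical
  by_contra! hc
  obtain ⟨T, hT, hc⟩ := exists_subset_card_eq (Nat.succ_le_of_lt hc)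
  refine h ⟨{u, v}, T, card_pair huv, hc, fun a ha b hb => ?_⟩
  have hb := hT hb
  simp only [mem_inter, mem_nbrs] at hb
  simp only [mem_insert, mem_singleton] at ha
  rcases ha with rfl | rfl
  exacts [hb.1, hb.2]

theorem codegree_le {r : α → β → Prop} (h : ¬ HasBiclique r 2) (u : α) :
    ∑ b ∈ nbrs r u, (dg (Function.swap r) b - 1) ≤ (Fintype.card α : ℤ) - 1 := by
  classical
  rw [← sum_card_nbrs_inter]
  calc _ ≤ ∑ v ∈ univ.erase u, (1 : ℤ) := sum_le_sum fun v hv => by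
        exact_mod_cast card_nbrs_inter_le_one h (ne_of_mem_erase hv).symm
    _ = _ := by
        have := card_erase_add_one (mem_univ u)
        simp only [sum_const, nsmul_eq_mul, mul_one]
        rw [card_univ] at this
        omega

/-! ### Edges without `K_{2,2}` -/

theorem four_le_dg {r : α → β → Prop} (hα : Fintype.card α = 18) (hβ : Fintype.card β = 18)
    (h : ¬ HasBiclique r 2) (hE : 83 ≤ ∑ a, dg r a) (u : α) : 4 ≤ dg r u := by
  classical
  set D : β → ℤ := dg (Function.swap r) with hD
  have hs : ∑ b, D b * (D b - 1) ≤ ∑ b ∈ nbrs r u, (D b - 1) + 289 := by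
    rw [← sum_codegree, ← add_sum_erase _ _ (mem_univ u)]
    gcongr
    calc _ ≤ ∑ v ∈ univ.erase u, (17 : ℤ) := sum_le_sum fun v hv => by
          simpa [hα] using codegree_le h v
      _ = 289 := by simp [card_erase_of_mem, card_univ, hα]
  -- The summand on the right is `(D - 4)(D - 5)`: nonnegative at integers, and at least `D - 5`.
  -- With `hs` this gives `4 * dg r u ≥ 15`.
  have hq : ∑ b ∈ nbrs r u, (D b - 1) - 4 * dg r u ≤ ∑ b, (D b * (D b - 1) - 8 * D b + 20) := by
    calc _ = ∑ b ∈ nbrs r u, (D b - 5) := by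
          simp only [sum_sub_distrib, dg]; simp; ring
      _ ≤ ∑ b ∈ nbrs r u, (D b * (D b - 1) - 8 * D b + 20) :=
          sum_le_sum fun b _ => by nlinarith [sq_nonneg (D b - 5)]
      _ ≤ _ := sum_le_univ_sum_of_nonneg fun b => by
          rcases le_or_gt (D b) 4 with hb | hb <;> nlinarith
  have hr : ∑ b, (D b * (D b - 1) - 8 * D b + 20)
      = ∑ b, D b * (D b - 1) - 8 * ∑ a, dg r a + 360 := by
    rw [sum_add_distrib, sum_sub_distrib, ← mul_sum, hD, sum_dg_swap]
    simp [card_univ, hβ]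
  linarith

theorem dg_le_five {r : α → β → Prop} (hα : Fintype.card α = 18) (hβ : Fintype.card β = 18)
    (h : ¬ HasBiclique r 2) (hE : 83 ≤ ∑ a, dg r a) (u : α) : dg r u ≤ 5 := by
  have h4 : ∀ b, 4 ≤ dg (Function.swap r) b := fun b =>
    four_le_dg hβ hα (fun h' => h h'.swap) (by rwa [sum_dg_swap]) b
  have h1 := codegree_le h u
  have h2 : ∑ b ∈ nbrs r u, (3 : ℤ) ≤ ∑ b ∈ nbrs r u, (dg (Function.swap r) b - 1) :=
    sum_le_sum fun b _ => by linarith [h4 b]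
  simp only [sum_const, nsmul_eq_mul, hα] at h1 h2
  unfold dg
  push_cast at h1
  omega

/-- A subrelation of an `18 × 18` grid without `K_{2,2}` has at most 82 edges. -/
theorem sum_dg_le_of_not_hasBiclique_two {r : α → β → Prop} (hα : Fintype.card α = 18)
    (hβ : Fintype.card β = 18) (h : ¬ HasBiclique r 2) : ∑ a, dg r a ≤ 82 := by
  by_contra! hE
  replace hE : 83 ≤ ∑ a, dg r a := hE
  have h' : ¬ HasBiclique (Function.swap r) 2 := fun h' => h h'.swap
  have hE' : 83 ≤ ∑ b, dg (Function.swap r) b := by rwa [sum_dg_swap]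
  have a4 := four_le_dg hα hβ h hE
  have a5 := dg_le_five hα hβ h hE
  have b4 := four_le_dg hβ hα h' hE'
  have b5 := dg_le_five hβ hα h' hE'
  -- Degree 4 gives at most 4, as each term is at most 1; degree 5 gives at most 17 - 15 = 2. The
  -- bound interpolates these linearly. Summed over `u` it will yield `7E ≤ 576` for the edge count
  -- `E`.
  have hX : ∀ u, ∑ b ∈ nbrs r u, (dg (Function.swap r) b - 4) ≤ 12 - 2 * dg r u := by
    intro u
    have h1 := codegree_le h u
    have h2 : ∑ b ∈ nbrs r u, (dg (Function.swap r) b - 4) ≤ ∑ b ∈ nbrs r u, 1 :=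
      sum_le_sum fun b _ => by linarith [b5 b]
    have := a4 u
    have := a5 u
    simp only [sum_sub_distrib, sum_const, nsmul_eq_mul, hα] at h1 h2 ⊢
    simp only [dg] at *
    push_cast at h1
    omega
  have h1 := sum_le_sum fun u (_ : u ∈ univ) => hX u
  rw [sum_sum_nbrs, sum_sub_distrib, ← mul_sum] at h1
  have h2 : ∑ b, 5 * (dg (Function.swap r) b - 4)
      ≤ ∑ b, dg (Function.swap r) b * (dg (Function.swap r) b - 4) :=
    sum_le_sum fun b _ => by
      have := b4 b
      have := b5 b
      interval_cases dg (Function.swap r) b <;> norm_num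
  rw [← mul_sum, sum_sub_distrib, sum_dg_swap] at h2
  simp only [sum_const, card_univ, hβ, hα, nsmul_eq_mul] at h1 h2
  push_cast at h1 h2
  linarith

/-! ### Edges without `K_{3,3}` -/

/-- A triple of neighbours of `u` shared with two further vertices would form a `K_{3,3}`. -/
theorem sum_choose_three_le [DecidableEq α] [DecidableEq β] {r : α → β → Prop}
    (h : ¬ HasBiclique r 3) (u : α) :
    ∑ v ∈ univ.erase u, (#(nbrs r u ∩ nbrs r v)).choose 3 ≤ (#(nbrs r u)).choose 3 := by
  simp_rw [← card_powersetCard]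
  rw [← card_biUnion]
  · refine card_le_card (biUnion_subset.2 fun v _ => powersetCard_mono inter_subset_left)
  · intro v hv w hw hvw
    rw [Function.onFun, Finset.disjoint_left]
    intro T hT hT'
    rw [mem_powersetCard] at hT hT'
    have hv := ne_of_mem_erase hv
    have hw := ne_of_mem_erase hw
    refine h ⟨{u, v, w}, T, card_eq_three.2 ⟨u, v, w, hv.symm, hw.symm, hvw, rfl⟩, hT.2,
      fun a ha b hb => ?_⟩
    have h1 := hT.1 hb
    have h2 := hT'.1 hb
    simp only [mem_inter, mem_nbrs] at h1 h2
    simp only [mem_insert, mem_singleton] at ha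
    rcases ha with rfl | rfl | rfl
    exacts [h1.1, h1.2, h2.2]

/-- The chord of `k.choose 3` through 4 and 5; the next lemma uses the chord through 3 and 4. -/
theorem six_mul_le_choose_three (k : ℕ) : (6 * k : ℤ) - 20 ≤ (k.choose 3 : ℕ) := by
  induction k with
  | zero => simp
  | succ k ih =>
    have h2 : (k + 1).choose 3 = k.choose 2 + k.choose 3 := Nat.choose_succ_succ k 2
    rcases Nat.lt_or_ge k 4 with hk | hk
    · interval_cases k <;> simp [Nat.choose]
    · have := Nat.choose_le_choose 2 hk
      have h6 : Nat.choose 4 2 = 6 := rfl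
      push_cast [h2]
      omega

theorem three_mul_le_choose_three (k : ℕ) : (3 * k : ℤ) - 8 ≤ (k.choose 3 : ℕ) := by
  rcases Nat.lt_or_ge k 4 with hk | hk
  · interval_cases k <;> simp [Nat.choose]
  · have := six_mul_le_choose_three k
    omega

/-- The quadratic is chosen to cancel when both sides of the grid are summed, leaving `20E ≤ 2 * 18
* 88`. It is tight at degrees 8 and 9, from the two chords respectively. -/
theorem codegree_add_le {r : α → β → Prop} (hα : Fintype.card α = 18)
    (hβ : Fintype.card β = 18) (h : ¬ HasBiclique r 3) (u : α) :
    ∑ b ∈ nbrs r u, (dg (Function.swap r) b - 1) + 10 * dg r u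
      ≤ dg r u * (dg r u - 1) + 88 := by
  classical
  rw [← sum_card_nbrs_inter]
  have h0 : (∑ v ∈ univ.erase u, ((#(nbrs r u ∩ nbrs r v)).choose 3 : ℤ))
      ≤ ((#(nbrs r u)).choose 3 : ℕ) := by
    exact_mod_cast sum_choose_three_le h u
  have h6 := (sum_le_sum fun v (_ : v ∈ univ.erase u) =>
    six_mul_le_choose_three #(nbrs r u ∩ nbrs r v)).trans h0
  have h3 := (sum_le_sum fun v (_ : v ∈ univ.erase u) =>
    three_mul_le_choose_three #(nbrs r u ∩ nbrs r v)).trans h0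
  rw [sum_sub_distrib, ← mul_sum] at h6 h3
  have hc : #(univ.erase u) = 17 := by simp [card_erase_of_mem, card_univ, hα]
  simp only [sum_const, hc, nsmul_eq_mul] at h6 h3
  have hd : #(nbrs r u) ≤ 18 := hβ ▸ card_le_univ _
  unfold dg
  generalize #(nbrs r u) = d at *
  generalize ∑ v ∈ univ.erase u, (#(nbrs r u ∩ nbrs r v) : ℤ) = s at *
  clear h0
  interval_cases d <;> norm_num [Nat.choose] at h6 h3 ⊢ <;> omega

/-- A subrelation of an `18 × 18` grid without `K_{3,3}` has at most 158 edges. -/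
theorem sum_dg_le_of_not_hasBiclique_three {r : α → β → Prop} (hα : Fintype.card α = 18)
    (hβ : Fintype.card β = 18) (h : ¬ HasBiclique r 3) : ∑ a, dg r a ≤ 158 := by
  have h1 := sum_le_sum fun u (_ : u ∈ univ) => codegree_add_le hα hβ h u
  have h2 := sum_le_sum fun u (_ : u ∈ univ) =>
    codegree_add_le hβ hα (r := Function.swap r) (fun h' => h h'.swap) u
  have e2 := sum_codegree (Function.swap r)
  have hrr : Function.swap (Function.swap r) = r := rfl
  rw [hrr] at e2
  simp only [hrr] at h2
  rw [sum_add_distrib, sum_add_distrib, sum_codegree, ← mul_sum] at h1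
  rw [sum_add_distrib, sum_add_distrib, e2, ← mul_sum, sum_dg_swap] at h2
  simp only [sum_const, card_univ, hβ, hα, nsmul_eq_mul] at h1 h2
  push_cast at h1 h2
  linarith

/-- Every 3-colouring of an `18 × 18` grid has a `2 × 2` biclique in one of the first two colours
or a `3 × 3` biclique in the third one. -/
theorem exists_hasBiclique (hα : Fintype.card α = 18) (hβ : Fintype.card β = 18)
    (c : α → β → Fin 3) :
    ∃ i, HasBiclique (fun a b => c a b = i) ((![2, 2, 3] : Fin 3 → ℕ) i) := by
  by_contra! hc
  have h0 := sum_dg_le_of_not_hasBiclique_two hα hβ (hc 0)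
  have h1 := sum_dg_le_of_not_hasBiclique_two hα hβ (hc 1)
  have h2 := sum_dg_le_of_not_hasBiclique_three hα hβ (hc 2)
  have hs : ∀ a, ∑ i, dg (fun a b => c a b = i) a = 18 := by
    intro a
    have := card_eq_sum_card_fiberwise (f := c a) (s := univ) (t := univ) (by simp)
    rw [card_univ, hβ] at this
    simp only [dg, nbrs]
    rw [← Nat.cast_sum]
    norm_cast
    rw [this]
  have ht := sum_congr rfl fun a (_ : a ∈ univ) => hs a
  rw [sum_comm, Fin.sum_univ_three] at ht
  simp only [sum_const, card_univ, hα, nsmul_eq_mul] at ht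
  push_cast at ht
  linarith

end Counting

/-! ### The colouring of the 16 × 16 grid -/

section Colouring

/-- A colouring of the grid `(ℤ/4)² × (ℤ/4)²` depends on the difference of its coordinates. -/
def differenceColour (g : ZMod 4 × ZMod 4) : Fin 3 :=
  if g ∈ [(0, 0), (0, 1), (1, 0), (3, 3)] then 0
  else if g ∈ [(0, 2), (1, 1), (1, 2), (2, 3)] then 1 else 2

/-- The first two colour classes are Sidon sets: no nonzero difference occurs twice. -/
theorem card_differenceColour_two_le : ∀ i : Fin 3, i ≠ 2 → ∀ v : ZMod 4 × ZMod 4, v ≠ 0 →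
    #{b | differenceColour b = i ∧ differenceColour (b - v) = i} ≤ 1 := by
  decide +kernel

theorem card_differenceColour_three_le : ∀ v w : ZMod 4 × ZMod 4, v ≠ 0 → w ≠ 0 → v ≠ w →
    #{b | differenceColour b = 2 ∧ differenceColour (b - v) = 2 ∧ differenceColour (b - w) = 2}
      ≤ 2 := by
  decide +kernel

theorem not_hasBiclique_differenceColour (i : Fin 3) :
    ¬ HasBiclique (fun a b => differenceColour (b - a) = i) ((![2, 2, 3] : Fin 3 → ℕ) i) := by
  rintro ⟨S, T, hS, hT, h⟩
  have key : ∀ u, #(T.image (· - u)) = #T := fun u =>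
    card_image_of_injective _ (sub_left_injective)
  by_cases hi : i = 2
  · subst hi
    obtain ⟨u, v, w, huv, huw, hvw, rfl⟩ := card_eq_three.1 hS
    have h1 := card_differenceColour_three_le (v - u) (w - u) (sub_ne_zero.2 huv.symm)
      (sub_ne_zero.2 huw.symm) (fun e => hvw (sub_left_injective e))
    have h2 : T.image (· - u) ⊆ univ.filter (fun b => differenceColour b = 2 ∧
        differenceColour (b - (v - u)) = 2 ∧ differenceColour (b - (w - u)) = 2) := by
      intro x hx
      obtain ⟨b, hb, rfl⟩ := mem_image.1 hx
      simp only [mem_filter, mem_univ, true_and, sub_sub_sub_cancel_right]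
      exact ⟨h u (by simp) b hb, h v (by simp) b hb, h w (by simp) b hb⟩
    have h3 := (card_le_card h2).trans h1
    rw [key, hT] at h3
    exact absurd h3 (by decide)
  · have ht : (![2, 2, 3] : Fin 3 → ℕ) i = 2 := by
      clear hS hT h
      revert i
      decide
    rw [ht] at hS hT
    obtain ⟨u, v, huv, rfl⟩ := card_eq_two.1 hS
    have h1 := card_differenceColour_two_le i hi (v - u) (sub_ne_zero.2 huv.symm)
    have h2 : T.image (· - u) ⊆
        univ.filter (fun b => differenceColour b = i ∧ differenceColour (b - (v - u)) = i) := by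
      intro x hx
      obtain ⟨b, hb, rfl⟩ := mem_image.1 hx
      simp only [mem_filter, mem_univ, true_and, sub_sub_sub_cancel_right]
      exact ⟨h u (by simp) b hb, h v (by simp) b hb⟩
    have h3 := (card_le_card h2).trans h1
    rw [key, hT] at h3
    omega

theorem HasBiclique.of_comp {α β γ δ : Type*} {r : γ → δ → Prop} (f : α ↪ γ) (g : β ↪ δ) {t : ℕ}
    (h : HasBiclique (fun a b => r (f a) (g b)) t) : HasBiclique r t := by
  obtain ⟨S, T, hS, hT, h⟩ := h
  exact ⟨S.map f, T.map g, by simpa, by simpa, by simpa using h⟩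

end Colouring

/-! ### Bicliques as subgraph copies -/

section Labelling

open SimpleGraph

theorem HasBiclique.of_isContained {α β : Type*} {G : SimpleGraph (α ⊕ β)}
    (hG : G ≤ completeBipartiteGraph α β) {t : ℕ} (ht : 0 < t)
    (h : completeBipartiteGraph (Fin t) (Fin t) ⊑ G) :
    HasBiclique (fun a b => G.Adj (Sum.inl a) (Sum.inr b)) t := by
  obtain ⟨L, R, hL, hR, h⟩ := completeBipartiteGraph_isContained_iff.1 h
  rw [Fintype.card_fin] at hL hR
  -- A copy may sit in the host either way round.
  have swap : ∀ (S T : Finset (α ⊕ β)), #S = t → #T = t → (∀ x ∈ S, ∀ y ∈ T, G.Adj x y) →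
      ∀ x ∈ S, x.isLeft → HasBiclique (fun a b => G.Adj (Sum.inl a) (Sum.inr b)) t := by
    intro S T hS hT hST x hx hxl
    have hTr : ∀ y ∈ T, y.isRight := fun y hy => by
      have := hG (hST x hx y hy)
      cases x <;> cases y <;> simp_all
    obtain ⟨y, hy⟩ := card_pos.1 (hT ▸ ht)
    have hSl : ∀ x ∈ S, x.isLeft := fun x hx => by
      have := hG (hST x hx y hy)
      have := hTr y hy
      cases x <;> cases y <;> simp_all
    refine ⟨S.toLeft, T.toRight, ?_, ?_, fun a ha b hb => hST _ (by simpa using ha) _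
      (by simpa using hb)⟩
    · have h0 : S.toRight = ∅ := eq_empty_of_forall_notMem fun b hb => by
        simpa using hSl _ (mem_toRight.1 hb)
      have := card_toLeft_add_card_toRight (u := S)
      simp_all
    · have h0 : T.toLeft = ∅ := eq_empty_of_forall_notMem fun b hb => by
        simpa using hTr _ (mem_toLeft.1 hb)
      have := card_toLeft_add_card_toRight (u := T)
      simp_all
  obtain ⟨x, hx⟩ := card_pos.1 (hL ▸ ht)
  obtain ⟨y, hy⟩ := card_pos.1 (hR ▸ ht)
  have hxy := hG (h hx hy)
  rcases hxy with hxy | hxy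
  · exact swap L R hL hR (fun x hx y hy => h hx hy) x hx hxy.1
  · exact swap R L hR hL (fun y hy x hx => (h hx hy).symm) y hy hxy.2

theorem HasBiclique.isContained {α β : Type*} {G : SimpleGraph (α ⊕ β)} {t : ℕ}
    (h : HasBiclique (fun a b => G.Adj (Sum.inl a) (Sum.inr b)) t) :
    completeBipartiteGraph (Fin t) (Fin t) ⊑ G := by
  obtain ⟨S, T, hS, hT, h⟩ := h
  refine completeBipartiteGraph_isContained_iff.2
    ⟨S.map .inl, T.map .inr, by simpa, by simpa, ?_⟩
  intro x hx y hy
  simp only [coe_map, Set.mem_image, mem_coe, Function.Embedding.inl_apply,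
    Function.Embedding.inr_apply] at hx hy
  obtain ⟨a, ha, rfl⟩ := hx
  obtain ⟨b, hb, rfl⟩ := hy
  exact h a ha b hb

/-- The edge labelling of a complete bipartite graph given by a function of the two ends. -/
def gridLabeling {α β K : Type*} (c : α → β → K) : (completeBipartiteGraph α β).EdgeLabeling K :=
  EdgeLabeling.mk
    (fun
      | .inl a, .inr b, _ => c a b
      | .inr b, .inl a, _ => c a b
      | .inl _, .inl _, h => absurd h (by simp)
      | .inr _, .inr _, h => absurd h (by simp))
    (by rintro (a | a) (b | b) _ <;> rfl)

theorem gridLabeling_labelGraph_adj {α β K : Type*} (c : α → β → K) (k : K) (a : α) (b : β) :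
    ((gridLabeling c).labelGraph k).Adj (.inl a) (.inr b) ↔ c a b = k := by
  rw [EdgeLabeling.labelGraph_adj]
  exact ⟨fun ⟨_, h⟩ => h, fun h => ⟨by simp, h⟩⟩

end Labelling

theorem bipartiteArrows_eighteen : BipartiteArrows ![2, 2, 3] 18 := by
  intro C
  obtain ⟨i, hi⟩ := exists_hasBiclique (Fintype.card_fin 18) (Fintype.card_fin 18)
    fun a b => C.get (Sum.inl a) (Sum.inr b) (by simp)
  refine ⟨i, HasBiclique.isContained ?_⟩
  convert hi using 3 with a b
  rw [SimpleGraph.EdgeLabeling.labelGraph_adj]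
  exact ⟨fun ⟨_, h⟩ => h, fun h => ⟨by simp, h⟩⟩

theorem not_bipartiteArrows_of_le_sixteen {n : ℕ} (hn : n ≤ 16) :
    ¬ BipartiteArrows ![2, 2, 3] n := by
  intro h
  obtain ⟨f⟩ : Nonempty (Fin n ↪ ZMod 4 × ZMod 4) :=
    Function.Embedding.nonempty_of_card_le (by simpa [ZMod.card] using hn)
  obtain ⟨i, hi⟩ := h (gridLabeling fun a b => differenceColour (f b - f a))
  have ht : 0 < (![2, 2, 3] : Fin 3 → ℕ) i := by
    clear hi
    revert i
    decide
  have hb := HasBiclique.of_isContained (SimpleGraph.EdgeLabeling.labelGraph_le _) ht hi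
  simp only [gridLabeling_labelGraph_adj] at hb
  exact not_hasBiclique_differenceColour i
    (HasBiclique.of_comp (r := fun x y => differenceColour (y - x) = i) f f hb)

theorem theorem3p2 :
    17 ≤ bipartiteRamsey (k := 3) ![2, 2, 3] ∧ bipartiteRamsey (k := 3) ![2, 2, 3] ≤ 18 := by
  -- Nonemptiness matters: the infimum of the empty set would be 0.
  refine ⟨le_csInf ⟨18, bipartiteArrows_eighteen⟩ fun n hn => ?_,
    Nat.sInf_le bipartiteArrows_eighteen⟩
  by_contra! hlt
  exact not_bipartiteArrows_of_le_sixteen (Nat.le_of_lt_succ hlt) hn
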